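/- Notation. $K_n^{(k)}$ is the complete $k$-uniform hypergraph on $n$ vertices. For a $k$-uniform hypergraph $G$ and integers $q\ge p$, $r_k(G;q,p)$ is the smallest integer $n$ such that every colouring of the edges of $K_n^{(k)}$ with $q$ colours contains a copy of $G$ whose edges span fewer than $p$ colours. The $k$-uniform balanced hedgehog $\hat H_t=\hat H^{(k)}_t$ with body of order $t$ has as vertices a set $S$ of $t$ vertices (the body) and, for each subset $X\subset S$ of order $\lceil k/2\rceil$, a set $A_X$ of $k-\lceil k/2\rceil$ further vertices, where the sets $A_X$ are pairwise disjoint and disjoint from $S$; its edges are the sets $X\cup A_X$. The tower $T_h(x)$ is defined by $T_1(x)=x$ and $T_{h+1}(x)=2^{T_h(x)}$ for $h\ge 1$, with the convention $T_0(x)=x$. Theorem (balanced hedgehogs). There exist a real $c>0$ and a function $q:\mathbb N\to\mathbb N$ with $q(k)\ge 2$ for all $k$, such that for every $k\in\mathbb N$ and all $t$ sufficiently large (depending on $k$), (a) $r_{2k+1}(\hat H_t;2,2)\le t^{k+3}$, and (b) $r_{2k+1}(\hat H_t;q(k),2)\ge T_{\lfloor c\log_2\log_2 k\rfloor}(t)$,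 where for $k\le 1$ the expression $\log_2\log_2 k$ is read as $0$. -/

import Mathlib

namespace HypergraphRamsey

/-- The complete `k`-uniform hypergraph on `n` vertices: the edges are all `k`-sets. -/
def completeUniform (n k : ℕ) : Hypergraph (Fin n) where
  vertexSet := Set.univ
  edgeSet := {e | e.ncard = k}
  subset_vertexSet_of_mem_edgeSet' := fun _ _ => Set.subset_univ _

/-- In every colouring of the edges of the complete `k`-uniform hypergraph on `n` vertices with
`q` colours there is a copy of `G` (an injection `f` of its vertices that sends edges to edges)
whose edges span fewer than `p` colours. -/
def IsRamsey {α : Type*} (k : ℕ) (G : Hypergraph α) (q p n : ℕ) : Prop :=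
  ∀ χ : (completeUniform n k).edgeSet → Fin q,
    ∃ f : G.vertexSet ↪ Fin n,
      (∀ e ∈ G.edgeSet, f '' {v | (v : α) ∈ e} ∈ (completeUniform n k).edgeSet) ∧
      (χ '' {d | ∃ e ∈ G.edgeSet, f '' {v | (v : α) ∈ e} = d}).ncard < p

/-- The Ramsey number `r_k(G; q, p)`: the smallest `n` such that every `q`-colouring of the
complete `k`-uniform hypergraph on `n` vertices contains a copy of `G` spanning fewer than `p`
colours. It takes values in `ℕ∞`, with value `⊤` if there were no such `n`, so that an upper bound
by a natural number contains the existence of such an `n`. -/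
noncomputable def ramseyNumber {α : Type*} (k : ℕ) (G : Hypergraph α) (q p : ℕ) : ℕ∞ :=
  ⨅ n ∈ {n : ℕ | IsRamsey k G q p n}, (n : ℕ∞)

/-- Vertices of the generalized hedgehog: the body `Fin t`, and for each `s`-subset `S` of the body
`k - s` further vertices of its own. -/
abbrev HedgehogVertex (t k s : ℕ) : Type :=
  Fin t ⊕ ({S : Finset (Fin t) // S.card = s} × Fin (k - s))

/-- The edge of the generalized hedgehog that belongs to the `s`-subset `S` of the body: `S` together
with the `k - s` further vertices of `S`. -/
def hedgehogEdge (t k s : ℕ) (S : {S : Finset (Fin t) // S.card = s}) :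
    Set (HedgehogVertex t k s) :=
  Sum.inl '' {x | x ∈ S.1} ∪ Set.range fun i : Fin (k - s) => Sum.inr (S, i)

/-- The generalized hedgehog with body of order `t`, uniformity `k` (for `s ≤ k`), and one edge for
each `s`-subset of the body. -/
def generalizedHedgehog (t k s : ℕ) : Hypergraph (HedgehogVertex t k s) where
  vertexSet := Set.univ
  edgeSet := Set.range (hedgehogEdge t k s)
  subset_vertexSet_of_mem_edgeSet' := fun _ _ => Set.subset_univ _

/-- The `k`-uniform balanced hedgehog with body of order `t`; here `(k + 1) / 2 = ⌈k / 2⌉`. -/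
def balancedHedgehog (k t : ℕ) : Hypergraph (HedgehogVertex t k ((k + 1) / 2)) :=
  generalizedHedgehog t k ((k + 1) / 2)

/-- The tower `T_h(x)` of height `h` in `x`: `T_1(x) = x` and `T_{h+1}(x) = 2 ^ T_h(x)` for `h ≥ 1`,
with the convention `T_0(x) = x`. -/
def tower : ℕ → ℕ → ℕ
  | 0, x => x
  | 1, x => x
  | h + 2, x => 2 ^ tower (h + 1) x

end HypergraphRamsey

/-! For (a), a (k+1)-set is bad for a colour if some D vertices meet all its extensions to an edge
of that colour (`IsBad`). With D at least the order of the hedgehog, a t-set without bad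
(k+1)-subsets for some colour is the body of a monochromatic hedgehog, found greedily
(`exists_monochromatic_hedgehog`). If there is no such t-set, `card_poor_lt` gives a vertex v which,
for each colour, lies in bad sets that otherwise avoid any few given vertices. So for each colour v
is the centre of many bad sets that are disjoint apart from v. One bad set for each colour can be
picked so that an edge contains both and its remaining vertices miss both blocking sets; this edge
can have neither colour (`exists_forall_not_isBad`).

For (b), avoiding colourings (`HasAvoidingColouring`) are stepped up from numbers below N to numbers
below 2^N. A set e of numbers spans a binary tree, and `levels e` has fewer elements than e. A large
set contains a long left comb, a long right comb or a deep complete binary tree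
(`card_le_of_no_comb_of_no_tree`). On a comb the old colouring, applied to the levels, does the
work. For trees a second coordinate with three values is used: u-sets that are left combs, right
combs or free of long combs overlap so little that an edge of fewer than about 3u vertices misses
one of the kinds, while a complete tree contains all three (`IsCompleteTree.exists_missingKind_ne`).
Balance matters here: an edge has about 2u vertices when the body part has u.

One step (`HasAvoidingColouring.step`) exponentiates N, raises t only to a fixed power, adds one to
u and m, and triples the number of colours. Starting from about log t vertices, H steps give a tower
of height H in t (`tower_le_ramseyNumber`). -/

namespace HypergraphRamsey

/-! ### Two colours: bad sets and the polynomial upper bound -/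

/-- Pairwise disjoint sets can be chosen greedily if each choice can avoid any `D` given vertices. -/
lemma exists_pairwise_disjoint_of_avoid {ι V : Type*} [DecidableEq V] (J : Finset ι)
    (P : ι → Finset V → Prop) (k D : ℕ) (U : Finset V) (hD : U.card + J.card * k ≤ D)
    (hP : ∀ i ∈ J, ∀ W : Finset V, W.card ≤ D → ∃ A, A.card = k ∧ Disjoint A W ∧ P i A) :
    ∃ A : ι → Finset V, (∀ i ∈ J, (A i).card = k ∧ Disjoint (A i) U ∧ P i (A i)) ∧
      ∀ i ∈ J, ∀ j ∈ J, i ≠ j → Disjoint (A i) (A j) := by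
  classical
  induction J using Finset.induction_on with
  | empty => exact ⟨fun _ => ∅, by simp, by simp⟩
  | insert a J ha ih =>
    rw [Finset.card_insert_of_notMem ha, add_mul] at hD
    obtain ⟨A, hA, hdis⟩ := ih (by omega) fun i hi => hP i (Finset.mem_insert_of_mem hi)
    have hW : (U ∪ J.biUnion A).card ≤ D := by
      have h1 := Finset.card_union_le U (J.biUnion A)
      have h2 : (J.biUnion A).card ≤ J.card * k :=
        Finset.card_biUnion_le_card_mul _ _ _ fun i hi => (hA i hi).1.le
      omega
    obtain ⟨B, hB, hBd, hBP⟩ := hP a (Finset.mem_insert_self _ _) _ hW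
    rw [Finset.disjoint_union_right, Finset.disjoint_biUnion_right] at hBd
    have hne : ∀ i ∈ J, i ≠ a := fun i hi h => ha (h ▸ hi)
    refine ⟨Function.update A a B, ?_, ?_⟩
    · intro i hi
      rcases Finset.mem_insert.1 hi with rfl | hi
      · rw [Function.update_self]; exact ⟨hB, hBd.1, hBP⟩
      · rw [Function.update_of_ne (hne i hi)]; exact hA i hi
    · intro i hi j hj hij
      rcases Finset.mem_insert.1 hi with hia | hi'
      · rcases Finset.mem_insert.1 hj with hja | hj'
        · exact absurd (hia.trans hja.symm) hij
        · rw [hia, Function.update_self, Function.update_of_ne (hne j hj')]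
          exact hBd.2 j hj'
      · rcases Finset.mem_insert.1 hj with hja | hj'
        · rw [hja, Function.update_self, Function.update_of_ne (hne i hi')]
          exact (hBd.2 i hi').symm
        · rw [Function.update_of_ne (hne i hi'), Function.update_of_ne (hne j hj')]
          exact hdis i hi' j hj' hij

/-- In a large set with small out-neighbourhoods `W` there is a `t`-set whose every nonempty subset
has an element with no out-neighbour in it. -/
lemma exists_subset_forall_disjoint {V : Type*} [DecidableEq V] (W : V → Finset V) (E t : ℕ)
    (P : Finset V) (hW : ∀ v ∈ P, (W v).card ≤ E) (hP : t * (E + 1) ≤ P.card) :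
    ∃ T ⊆ P, T.card = t ∧
      ∀ X ⊆ T, X.Nonempty → ∃ v ∈ X, Disjoint (X.erase v) (W v) := by
  induction t generalizing P with
  | zero =>
    refine ⟨∅, Finset.empty_subset _, rfl, fun X hX hne => ?_⟩
    exact absurd (Finset.subset_empty.1 hX) hne.ne_empty
  | succ t ih =>
    rw [add_mul, one_mul] at hP
    -- Later elements are chosen outside `W v`, so in any subset the element that was chosen first
    -- is the required one.
    obtain ⟨v, hv⟩ : P.Nonempty := Finset.card_pos.1 (by omega)
    have hcard : t * (E + 1) ≤ (P \ insert v (W v)).card := by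
      have h1 := Finset.le_card_sdiff (insert v (W v)) P
      have h2 := Finset.card_insert_le v (W v)
      have h3 := hW v hv
      omega
    obtain ⟨T, hT, hTc, hTX⟩ := ih (P \ insert v (W v))
      (fun w hw => hW w (Finset.mem_sdiff.1 hw).1) hcard
    have hT' : ∀ x ∈ T, x ≠ v ∧ x ∉ W v := fun x hx => by
      simpa using (Finset.mem_sdiff.1 (hT hx)).2
    refine ⟨insert v T, Finset.insert_subset hv (hT.trans Finset.sdiff_subset), ?_, ?_⟩
    · rw [Finset.card_insert_of_notMem (fun h => (hT' v h).1 rfl), hTc]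
    · intro X hX hne
      by_cases hvX : v ∈ X
      · refine ⟨v, hvX, Finset.disjoint_left.2 fun x hx => ?_⟩
        obtain ⟨hxv, hxX⟩ := Finset.mem_erase.1 hx
        exact (hT' x (Finset.mem_of_mem_insert_of_ne (hX hxX) hxv)).2
      · exact hTX X ((Finset.subset_insert_iff_of_notMem hvX).1 hX) hne

/-- `X` is bad for the colour `c` if it has few vertices that meet all extensions of `X` by `k`
vertices to a set of colour `c`. -/
def IsBad {V : Type*} [DecidableEq V] {q : ℕ} (col : Finset V → Fin q) (k D : ℕ) (c : Fin q)
    (X : Finset V) : Prop :=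
  ∃ U : Finset V, U.card ≤ D ∧
    ∀ A : Finset V, A.card = k → Disjoint A X → Disjoint A U → col (X ∪ A) ≠ c

/-- All but few vertices lie in members of `F` that avoid any few given vertices, if every `t`-set
contains a member of `F`. -/
lemma card_poor_lt {V : Type*} [DecidableEq V] (F : Set (Finset V)) (E t : ℕ)
    (hF : ∀ T : Finset V, T.card = t → ∃ X ⊆ T, X.Nonempty ∧ X ∈ F) (P : Finset V)
    (hP : ∀ v ∈ P, ∃ W : Finset V, W.card ≤ E ∧ ∀ X ∈ F, v ∈ X → ¬ Disjoint (X.erase v) W) :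
    P.card < t * (E + 1) := by
  by_contra! h
  choose! W hW hWF using hP
  obtain ⟨T, hT, hTc, hTX⟩ := exists_subset_forall_disjoint W E t P hW h
  obtain ⟨X, hX, hne, hXF⟩ := hF T hTc
  obtain ⟨v, hv, hd⟩ := hTX X hX hne
  exact hWF v (hT (hX hv)) X hXF hv hd

/-- Few members of a disjoint family meet a small set. -/
lemma card_filter_not_disjoint_le {ι V : Type*} [DecidableEq V] [Fintype ι] (A : ι → Finset V)
    (hA : ∀ i j, i ≠ j → Disjoint (A i) (A j)) (U : Finset V) :
    (Finset.univ.filter fun i => ¬ Disjoint (A i) U).card ≤ U.card := by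
  classical
  have h : ∀ i ∈ Finset.univ.filter fun i => ¬ Disjoint (A i) U, ∃ u, u ∈ A i ∧ u ∈ U :=
    fun i hi => Finset.not_disjoint_iff.1 (Finset.mem_filter.1 hi).2
  rcases U.eq_empty_or_nonempty with rfl | ⟨u₀, -⟩
  · simp
  have : Nonempty V := ⟨u₀⟩
  choose! f hf hfU using h
  refine Finset.card_le_card_of_injOn f (fun i hi => hfU i hi) fun i hi j hj hij => ?_
  by_contra hne
  exact Finset.disjoint_left.1 (hA i j hne) (hf i hi) (hij ▸ hf j hj)

/-- Each `U i` meets at most `D` of the disjoint sets `B j`, and likewise for `W j` and `A i`. So at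
most `2 * D * M` of the `M * M` pairs fail. -/
lemma exists_mutually_disjoint {V : Type*} [DecidableEq V] {M D : ℕ} (hM : 2 * D < M)
    (A B U W : Fin M → Finset V) (hA : ∀ i j, i ≠ j → Disjoint (A i) (A j))
    (hB : ∀ i j, i ≠ j → Disjoint (B i) (B j)) (hU : ∀ i, (U i).card ≤ D)
    (hW : ∀ i, (W i).card ≤ D) : ∃ i j, Disjoint (B j) (U i) ∧ Disjoint (A i) (W j) := by
  by_contra! h
  have hsub : (Finset.univ : Finset (Fin M × Fin M)) ⊆
      (Finset.univ.sigma fun i => Finset.univ.filter fun j => ¬ Disjoint (B j) (U i)).image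
        (fun p => (p.1, p.2)) ∪
      (Finset.univ.sigma fun j => Finset.univ.filter fun i => ¬ Disjoint (A i) (W j)).image
        (fun p => (p.2, p.1)) := by
    rintro ⟨i, j⟩ -
    rw [Finset.mem_union, Finset.mem_image, Finset.mem_image]
    by_cases hij : Disjoint (B j) (U i)
    · exact Or.inr ⟨⟨j, i⟩, by simpa using h i j hij, rfl⟩
    · exact Or.inl ⟨⟨i, j⟩, by simpa using hij, rfl⟩
  have h1 := (Finset.card_le_card hsub).trans
    ((Finset.card_union_le _ _).trans (add_le_add Finset.card_image_le Finset.card_image_le))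
  rw [Finset.card_sigma, Finset.card_sigma] at h1
  have h2 := Finset.sum_le_card_nsmul Finset.univ _ D
    fun i (_ : i ∈ Finset.univ) => (card_filter_not_disjoint_le B hB (U i)).trans (hU i)
  have h3 := Finset.sum_le_card_nsmul Finset.univ _ D
    fun j (_ : j ∈ Finset.univ) => (card_filter_not_disjoint_le A hA (W j)).trans (hW j)
  simp only [Finset.card_univ, Fintype.card_prod, Fintype.card_fin, smul_eq_mul] at h1 h2 h3
  nlinarith

/-- In every `2`-colouring some `t`-set has no bad `(k + 1)`-subset for one of the colours. -/
lemma exists_forall_not_isBad {k t n D : ℕ} (col : Finset (Fin n) → Fin 2)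
    (hn : 2 * (t * ((2 * D + 1) * k + 1)) ≤ n) (hn' : 2 * k + 1 + 2 * D ≤ n) :
    ∃ c : Fin 2, ∃ T : Finset (Fin n), T.card = t ∧
      ∀ X ⊆ T, X.card = k + 1 → ¬ IsBad col k D c X := by
  classical
  by_contra! hbad
  -- `E` is the number of vertices used up by `2 * D + 1` petals of size `k`.
  set E := (2 * D + 1) * k with hE
  let F : Fin 2 → Set (Finset (Fin n)) := fun c => {X | X.card = k + 1 ∧ IsBad col k D c X}
  let poor : Fin 2 → Finset (Fin n) := fun c => Finset.univ.filter fun v =>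
    ∃ W : Finset (Fin n), W.card ≤ E ∧ ∀ X ∈ F c, v ∈ X → ¬ Disjoint (X.erase v) W
  have hpoor : ∀ c, (poor c).card < t * (E + 1) := fun c =>
    card_poor_lt (F c) E t (fun T hT => by
      obtain ⟨X, hX, hXc, hXb⟩ := hbad c T hT
      exact ⟨X, hX, Finset.card_pos.1 (by omega), hXc, hXb⟩) (poor c)
      fun v hv => (Finset.mem_filter.1 hv).2
  obtain ⟨v, hv⟩ : ∃ v, v ∉ poor 0 ∪ poor 1 := by
    by_contra! h
    have h1 := Finset.card_le_card (fun v _ => h v : Finset.univ ⊆ poor 0 ∪ poor 1)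
    have h2 := Finset.card_union_le (poor 0) (poor 1)
    have h3 := hpoor 0
    have h4 := hpoor 1
    rw [Finset.card_univ, Fintype.card_fin] at h1
    omega
  rw [Finset.mem_union, not_or] at hv
  have hfam : ∀ c, v ∉ poor c → ∃ A U : Fin (2 * D + 1) → Finset (Fin n),
      (∀ i j, i ≠ j → Disjoint (A i) (A j)) ∧ ∀ i, (A i).card = k ∧ v ∉ A i ∧ (U i).card ≤ D ∧
        ∀ Z : Finset (Fin n), Z.card = k → Disjoint Z (insert v (A i)) → Disjoint Z (U i) →
          col (insert v (A i) ∪ Z) ≠ c := by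
    intro c hc
    obtain ⟨A, hA, hdis⟩ := exists_pairwise_disjoint_of_avoid
      (Finset.univ : Finset (Fin (2 * D + 1))) (fun _ A => v ∉ A ∧ insert v A ∈ F c) k E ∅
      (by simp [hE]) fun _ _ W hW => by
        have : ¬ ∀ X ∈ F c, v ∈ X → ¬ Disjoint (X.erase v) W :=
          fun h => hc (Finset.mem_filter.2 ⟨Finset.mem_univ _, W, hW, h⟩)
        push Not at this
        obtain ⟨X, hX, hvX, hd⟩ := this
        refine ⟨X.erase v, ?_, hd, Finset.notMem_erase v X, by rwa [Finset.insert_erase hvX]⟩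
        rw [Finset.card_erase_of_mem hvX, hX.1]; rfl
    have hbadA : ∀ i, IsBad col k D c (insert v (A i)) :=
      fun i => (hA i (Finset.mem_univ _)).2.2.2.2
    choose U hU hUA using hbadA
    exact ⟨A, U, fun i j => hdis i (Finset.mem_univ _) j (Finset.mem_univ _), fun i =>
      ⟨(hA i (Finset.mem_univ _)).1, (hA i (Finset.mem_univ _)).2.2.1, hU i, hUA i⟩⟩
  obtain ⟨A, U, hA, hAU⟩ := hfam 0 hv.1
  obtain ⟨B, W, hB, hBW⟩ := hfam 1 hv.2
  obtain ⟨i, j, hij, hij'⟩ := exists_mutually_disjoint (Nat.lt_succ_self (2 * D)) A B U W hA hB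
    (fun i => (hAU i).2.2.1) fun i => (hBW i).2.2.1
  obtain ⟨cA, vA, cU, hcolA⟩ := hAU i
  obtain ⟨cB, vB, cW, hcolB⟩ := hBW j
  -- Since the two bad sets share `v`, their union fits into one edge; this is where the uniformity
  -- `2 * k + 1` is needed. The edge is filled up outside `U i ∪ W j`.
  have hXY : (insert v (A i ∪ B j)).card ≤ 2 * k + 1 := by
    have h1 := Finset.card_insert_le v (A i ∪ B j)
    have h2 := Finset.card_union_le (A i) (B j)
    omega
  have hrest : 2 * k + 1 ≤ (insert v (A i ∪ B j) ∪ (U i ∪ W j)ᶜ).card := by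
    have h1 := Finset.card_le_card
      (Finset.subset_union_right (s₁ := insert v (A i ∪ B j)) (s₂ := (U i ∪ W j)ᶜ))
    have h2 := Finset.card_union_le (U i) (W j)
    rw [Finset.card_compl, Fintype.card_fin] at h1
    omega
  obtain ⟨e, he, he', hec⟩ :=
    Finset.exists_subsuperset_card_eq Finset.subset_union_left hXY hrest
  have hmem : ∀ x ∈ e, x = v ∨ x ∈ A i ∨ x ∈ B j ∨ (x ∉ U i ∧ x ∉ W j) := fun x hx => by
    have := he' hx
    simp only [Finset.mem_union, Finset.mem_insert, Finset.mem_compl, not_or] at this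
    tauto
  have hXe : insert v (A i) ⊆ e :=
    (Finset.insert_subset_insert v Finset.subset_union_left).trans he
  have hYe : insert v (B j) ⊆ e :=
    (Finset.insert_subset_insert v Finset.subset_union_right).trans he
  have h0 := hcolA (e \ insert v (A i))
    (by rw [Finset.card_sdiff_of_subset hXe, Finset.card_insert_of_notMem vA]; omega)
    Finset.sdiff_disjoint (Finset.disjoint_left.2 fun x hx hxU => by
      simp only [Finset.mem_sdiff, Finset.mem_insert, not_or] at hx
      rcases hmem x hx.1 with h | h | h | h
      · exact hx.2.1 h
      · exact hx.2.2 h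
      · exact Finset.disjoint_left.1 hij h hxU
      · exact h.1 hxU)
  have h1 := hcolB (e \ insert v (B j))
    (by rw [Finset.card_sdiff_of_subset hYe, Finset.card_insert_of_notMem vB]; omega)
    Finset.sdiff_disjoint (Finset.disjoint_left.2 fun x hx hxW => by
      simp only [Finset.mem_sdiff, Finset.mem_insert, not_or] at hx
      rcases hmem x hx.1 with h | h | h | h
      · exact hx.2.1 h
      · exact Finset.disjoint_left.1 hij' h hxW
      · exact hx.2.2 h
      · exact h.2 hxW)
  rw [Finset.union_sdiff_of_subset hXe] at h0
  rw [Finset.union_sdiff_of_subset hYe] at h1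
  omega

/-- A body without bad sets for the colour `c` extends to a hedgehog of colour `c`. -/
lemma exists_monochromatic_hedgehog {n t K s q D : ℕ} (hs : s ≤ K)
    (χ : (completeUniform n K).edgeSet → Fin q) (col : Finset (Fin n) → Fin q)
    (hcol : ∀ (e : Finset (Fin n)) (he : (e : Set (Fin n)) ∈ (completeUniform n K).edgeSet),
      col e = χ ⟨e, he⟩) (c : Fin q) (T : Finset (Fin n)) (hT : T.card = t)
    (h : ∀ X ⊆ T, X.card = s → ¬ IsBad col (K - s) D c X)
    (hD : t + t.choose s * (K - s) ≤ D) :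
    ∃ f : (generalizedHedgehog t K s).vertexSet ↪ Fin n,
      (∀ e ∈ (generalizedHedgehog t K s).edgeSet,
        f '' {v | (v : HedgehogVertex t K s) ∈ e} ∈ (completeUniform n K).edgeSet) ∧
      (χ '' {d | ∃ e ∈ (generalizedHedgehog t K s).edgeSet,
        f '' {v | (v : HedgehogVertex t K s) ∈ e} = d}).ncard < 2 := by
  classical
  let b := T.orderEmbOfFin hT
  have hb : ∀ i, b i ∈ T := T.orderEmbOfFin_mem hT
  let X : {S : Finset (Fin t) // S.card = s} → Finset (Fin n) := fun S => S.1.map b.toEmbedding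
  have hXT : ∀ S, X S ⊆ T := fun S x hx => by
    obtain ⟨i, -, rfl⟩ := Finset.mem_map.1 hx
    exact hb i
  have hXc : ∀ S, (X S).card = s := fun S => by rw [Finset.card_map, S.2]
  -- The set avoided from the start is the whole body `T`, so that every `A S` is disjoint from all
  -- of it and not only from `X S`.
  obtain ⟨A, hA, hdis⟩ := exists_pairwise_disjoint_of_avoid
    (Finset.univ : Finset {S : Finset (Fin t) // S.card = s})
    (fun S A => Disjoint A (X S) ∧ col (X S ∪ A) = c) (K - s) D T
    (by rwa [Finset.card_univ, Fintype.card_finset_len, Fintype.card_fin, hT])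
    fun S _ W hW => by
      by_contra! hcon
      exact h (X S) (hXT S) (hXc S) ⟨W, hW, fun A hA hAX hAW hc => hcon A hA hAW hAX hc⟩
  have hAc : ∀ S, (A S).card = K - s := fun S => (hA S (Finset.mem_univ _)).1
  have hAT : ∀ S, Disjoint (A S) T := fun S => (hA S (Finset.mem_univ _)).2.1
  have hAX : ∀ S, Disjoint (A S) (X S) := fun S => (hA S (Finset.mem_univ _)).2.2.1
  have hcolA : ∀ S, col (X S ∪ A S) = c := fun S => (hA S (Finset.mem_univ _)).2.2.2
  let g : HedgehogVertex t K s → Fin n :=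
    Sum.elim b fun p => (A p.1).orderEmbOfFin (hAc p.1) p.2
  have hgA : ∀ S i, g (Sum.inr (S, i)) ∈ A S := fun S i => (A S).orderEmbOfFin_mem (hAc S) i
  have hg : Function.Injective g := by
    rintro (i | ⟨S, i⟩) (j | ⟨S', j⟩) hij
    · exact congrArg Sum.inl (b.injective hij)
    · exact absurd (hb i) (Finset.disjoint_left.1 (hAT S')
        ((congrArg (· ∈ A S') hij).mpr (hgA S' j)))
    · exact absurd (hb j) (Finset.disjoint_left.1 (hAT S)
        ((congrArg (· ∈ A S) hij).mp (hgA S i)))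
    · obtain rfl : S = S' := by
        by_contra hne
        exact Finset.disjoint_left.1 (hdis S (Finset.mem_univ _) S' (Finset.mem_univ _) hne)
          (hgA S i) (hij ▸ hgA S' j)
      obtain rfl : i = j := ((A S).orderEmbOfFin (hAc S)).injective hij
      rfl
  let f : (generalizedHedgehog t K s).vertexSet ↪ Fin n :=
    ⟨fun v => g v.1, fun v w hvw => Subtype.ext (hg hvw)⟩
  have himg : ∀ S, f '' {v | (v : HedgehogVertex t K s) ∈ hedgehogEdge t K s S} =
      (X S ∪ A S : Finset (Fin n)) := by
    intro S
    ext x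
    simp only [Set.mem_image, Finset.coe_union, Set.mem_union, Finset.mem_coe]
    constructor
    · rintro ⟨⟨v, hv⟩, ⟨i, hi, rfl⟩ | ⟨i, rfl⟩, rfl⟩
      · exact Or.inl (Finset.mem_map_of_mem _ hi)
      · exact Or.inr (hgA S i)
    · rintro (hx | hx)
      · obtain ⟨i, hi, rfl⟩ := Finset.mem_map.1 hx
        exact ⟨⟨Sum.inl i, trivial⟩, Or.inl ⟨i, hi, rfl⟩, rfl⟩
      · have : x ∈ Set.range ((A S).orderEmbOfFin (hAc S)) := by
          rw [Finset.range_orderEmbOfFin]; exact hx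
        obtain ⟨i, rfl⟩ := this
        exact ⟨⟨Sum.inr (S, i), trivial⟩, Or.inr ⟨i, rfl⟩, rfl⟩
  have hedge : ∀ S, ((X S ∪ A S : Finset (Fin n)) : Set (Fin n)) ∈
      (completeUniform n K).edgeSet := by
    intro S
    show Set.ncard _ = K
    rw [Set.ncard_coe_finset, Finset.card_union_of_disjoint (hAX S).symm, hXc, hAc]
    omega
  refine ⟨f, ?_, ?_⟩
  · rintro _ ⟨S, rfl⟩
    rw [himg]
    exact hedge S
  · have hsub : χ '' {d | ∃ e ∈ (generalizedHedgehog t K s).edgeSet,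
        f '' {v | (v : HedgehogVertex t K s) ∈ e} = d} ⊆ {c} := by
      rintro _ ⟨⟨d, hd⟩, ⟨_, ⟨S, rfl⟩, hde⟩, rfl⟩
      rw [himg] at hde
      change _ = d at hde
      subst hde
      rw [Set.mem_singleton_iff, ← hcol _ hd, hcolA]
    have := Set.ncard_le_ncard hsub
    rw [Set.ncard_singleton] at this
    omega

/-- With `D = (k + 1) * t ^ (k + 1)`, which bounds the order of the hedgehog, about `4 * k * D * t`
vertices suffice. The condition on `t` lets one factor `t` absorb the constant `8 * (k + 1) ^ 2`. -/
lemma isRamsey_balancedHedgehog {k t : ℕ} (ht : 8 * (k + 1) ^ 2 ≤ t) :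
    IsRamsey (2 * k + 1) (balancedHedgehog (2 * k + 1) t) 2 2 (t ^ (k + 3)) := by
  classical
  intro χ
  have hs : (2 * k + 1 + 1) / 2 = k + 1 := by omega
  have hk : 2 * k + 1 - (2 * k + 1 + 1) / 2 = k := by omega
  have ht1 : 1 ≤ t := by nlinarith
  set p := t ^ (k + 1) with hp
  have htp : t ≤ p := Nat.le_self_pow (by omega) t
  have hch : t.choose (k + 1) ≤ p := Nat.choose_le_pow t (k + 1)
  have hD : t + t.choose (k + 1) * k ≤ (k + 1) * p := by nlinarith
  have hpow : t ^ (k + 3) = p * t * t := by rw [hp]; ring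
  -- The value `0` on sets that are not edges plays no role: only unions of a `(k + 1)`-set and a
  -- disjoint `k`-set are tested.
  let col : Finset (Fin (t ^ (k + 3))) → Fin 2 := fun e =>
    if he : (e : Set (Fin (t ^ (k + 3)))) ∈ (completeUniform (t ^ (k + 3)) (2 * k + 1)).edgeSet
    then χ ⟨e, he⟩ else 0
  obtain ⟨c, T, hT, h⟩ := exists_forall_not_isBad (k := k) (t := t) (D := (k + 1) * p) col
    (by
      have h1 : (2 * ((k + 1) * p) + 1) * k + 1 ≤ 4 * (k + 1) ^ 2 * p := by nlinarith
      calc 2 * (t * ((2 * ((k + 1) * p) + 1) * k + 1)) ≤ 2 * (t * (4 * (k + 1) ^ 2 * p)) := by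
            gcongr
        _ = 8 * (k + 1) ^ 2 * (p * t) := by ring
        _ ≤ t * (p * t) := by gcongr
        _ = t ^ (k + 3) := by rw [hpow]; ring)
    (by
      have hp1 : 1 ≤ p := ht1.trans htp
      have h1 : k + 1 ≤ (k + 1) * p := Nat.le_mul_of_pos_right _ hp1
      have h2 : (k + 1) * p ≤ (k + 1) * ((k + 1) * p) := Nat.le_mul_of_pos_left _ (Nat.succ_pos k)
      calc 2 * k + 1 + 2 * ((k + 1) * p) ≤ 8 * ((k + 1) * ((k + 1) * p)) := by omega
        _ = 8 * (k + 1) ^ 2 * p := by ring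
        _ ≤ t * p := by gcongr
        _ ≤ t * p * t := Nat.le_mul_of_pos_right _ ht1
        _ = t ^ (k + 3) := by rw [hpow]; ring)
  refine exists_monochromatic_hedgehog (D := (k + 1) * p) (by omega) χ col
    (fun e he => dif_pos he) c T hT ?_ ?_
  · intro X hX hXc
    rw [hk]
    exact h X hX (by omega)
  · rw [hk, hs]
    exact hD

/-! ### Highest differing digits and branching levels -/

/-- The position of the highest binary digit in which `x` and `y` differ (and `0` if `x = y`). -/
noncomputable def topDiff (x y : ℕ) : ℕ := sInf {i | x / 2 ^ (i + 1) = y / 2 ^ (i + 1)}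

lemma topDiff_le_iff {x y i : ℕ} : topDiff x y ≤ i ↔ x / 2 ^ (i + 1) = y / 2 ^ (i + 1) := by
  have hne : {i | x / 2 ^ (i + 1) = y / 2 ^ (i + 1)}.Nonempty := by
    refine ⟨x + y, ?_⟩
    have h : x + y < 2 ^ (x + y + 1) :=
      Nat.lt_two_pow_self.trans (Nat.pow_lt_pow_right (by norm_num) (Nat.lt_succ_self _))
    simp only [Set.mem_ofPred_eq]
    rw [Nat.div_eq_of_lt (by omega), Nat.div_eq_of_lt (by omega)]
  constructor
  · intro h
    have h0 : x / 2 ^ (topDiff x y + 1) = y / 2 ^ (topDiff x y + 1) := Nat.sInf_mem hne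
    obtain ⟨j, rfl⟩ := Nat.exists_eq_add_of_le h
    rw [show topDiff x y + j + 1 = (topDiff x y + 1) + j by ring, pow_add, ← Nat.div_div_eq_div_mul,
      ← Nat.div_div_eq_div_mul, h0]
  · exact fun h => Nat.sInf_le h

lemma topDiff_lt {N x y : ℕ} (hx : x < 2 ^ N) (hy : y < 2 ^ N) (h : x < y) : topDiff x y < N := by
  cases N with
  | zero => simp at hx hy; omega
  | succ N =>
    rw [Nat.lt_succ_iff, topDiff_le_iff, Nat.div_eq_of_lt hx, Nat.div_eq_of_lt hy]

lemma topDiff_max {x y z : ℕ} (hxy : x < y) (hyz : y < z) :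
    topDiff x z = max (topDiff x y) (topDiff y z) := by
  refine eq_of_forall_ge_iff fun i => ?_
  rw [max_le_iff, topDiff_le_iff, topDiff_le_iff, topDiff_le_iff]
  have h1 := Nat.div_le_div_right (c := 2 ^ (i + 1)) hxy.le
  have h2 := Nat.div_le_div_right (c := 2 ^ (i + 1)) hyz.le
  omega

lemma div_two_pow_ne {x y i : ℕ} (hxy : x < y) (h : i ≤ topDiff x y) : x / 2 ^ i ≠ y / 2 ^ i := by
  cases i with
  | zero => simpa using hxy.ne
  | succ i =>
    intro h'
    have := topDiff_le_iff.2 h'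
    omega

/-- At the highest differing digit the smaller number has 0 and the larger has 1, so `y` would need
both. -/
lemma topDiff_ne {x y z : ℕ} (hxy : x < y) (hyz : y < z) : topDiff x y ≠ topDiff y z := by
  intro h
  have e1 : x / 2 ^ (topDiff x y + 1) = y / 2 ^ (topDiff x y + 1) := topDiff_le_iff.1 le_rfl
  have e2 : y / 2 ^ (topDiff x y + 1) = z / 2 ^ (topDiff x y + 1) := topDiff_le_iff.1 h.ge
  have n1 := div_two_pow_ne hxy le_rfl
  have n2 := div_two_pow_ne hyz h.le
  have h1 := Nat.div_le_div_right (c := 2 ^ topDiff x y) hxy.le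
  have h2 := Nat.div_le_div_right (c := 2 ^ topDiff x y) hyz.le
  simp only [pow_succ, ← Nat.div_div_eq_div_mul] at e1 e2
  omega

/-- The levels at which the binary tree spanned by `e` branches. -/
noncomputable def levels (e : Finset ℕ) : Finset ℕ :=
  ((e ×ˢ e).filter fun p => p.1 < p.2).image fun p => topDiff p.1 p.2

lemma mem_levels {e : Finset ℕ} {i : ℕ} :
    i ∈ levels e ↔ ∃ x ∈ e, ∃ y ∈ e, x < y ∧ topDiff x y = i := by
  simp only [levels, Finset.mem_image, Finset.mem_filter, Finset.mem_product, Prod.exists]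
  constructor
  · rintro ⟨x, y, ⟨⟨hx, hy⟩, h⟩, rfl⟩
    exact ⟨x, hx, y, hy, h, rfl⟩
  · rintro ⟨x, hx, y, hy, h, rfl⟩
    exact ⟨x, y, ⟨⟨hx, hy⟩, h⟩, rfl⟩

lemma levels_subset_range {N : ℕ} {e : Finset ℕ} (he : e ⊆ Finset.range (2 ^ N)) :
    levels e ⊆ Finset.range N := by
  intro i hi
  obtain ⟨x, hx, y, hy, h, rfl⟩ := mem_levels.1 hi
  exact Finset.mem_range.2 (topDiff_lt (Finset.mem_range.1 (he hx)) (Finset.mem_range.1 (he hy)) h)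

lemma card_levels_le (e : Finset ℕ) : (levels e).card ≤ e.card - 1 := by
  induction e using Finset.induction_on_min with
  | empty => simp [levels]
  | insert a e ha ih =>
    have hae : a ∉ e := fun h => (ha a h).false
    rw [Finset.card_insert_of_notMem hae]
    rcases e.eq_empty_or_nonempty with rfl | hne
    · simp [levels]
    · have hb := e.min'_mem hne
      set b := e.min' hne with hbdef
      -- By `topDiff_max`, the level of `a` and any `y` beyond `b` is either that of `a` and `b` or
      -- that of `b` and `y`, which is old.
      have hsub : levels (insert a e) ⊆ insert (topDiff a b) (levels e) := by
        intro i hi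
        obtain ⟨x, hx, y, hy, h, rfl⟩ := mem_levels.1 hi
        rw [Finset.mem_insert] at hx hy ⊢
        rcases hy with rfl | hy
        · rcases hx with rfl | hx
          · omega
          · have := ha x hx
            omega
        rcases hx with rfl | hx
        · rcases (e.min'_le y hy).eq_or_lt with hby | hby
          · left; rw [hbdef, hby]
          · rw [topDiff_max (ha b hb) hby]
            rcases max_choice (topDiff x b) (topDiff b y) with h' | h'
            · left; exact h'
            · right; rw [h']; exact mem_levels.2 ⟨b, hb, y, hy, hby, rfl⟩
        · right; exact mem_levels.2 ⟨x, hx, y, hy, h, rfl⟩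
      have h1 := Finset.card_le_card hsub
      have h2 := Finset.card_insert_le (topDiff a b) (levels e)
      have h3 := Finset.card_pos.2 hne
      omega

/-! ### Combs and complete binary trees -/

/-- The branching of the binary tree spanned by `S` runs along a path that always turns left. -/
def IsLeftComb (S : Finset ℕ) : Prop :=
  ∀ x ∈ S, ∀ y ∈ S, ∀ z ∈ S, x < y → y < z → topDiff x y < topDiff y z

/-- The branching of the binary tree spanned by `S` runs along a path that always turns right. -/
def IsRightComb (S : Finset ℕ) : Prop :=
  ∀ x ∈ S, ∀ y ∈ S, ∀ z ∈ S, x < y → y < z → topDiff y z < topDiff x y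

lemma IsLeftComb.mono {S S' : Finset ℕ} (h : IsLeftComb S) (hs : S' ⊆ S) : IsLeftComb S' :=
  fun x hx y hy z hz => h x (hs hx) y (hs hy) z (hs hz)

lemma IsRightComb.mono {S S' : Finset ℕ} (h : IsRightComb S) (hs : S' ⊆ S) : IsRightComb S' :=
  fun x hx y hy z hz => h x (hs hx) y (hs hy) z (hs hz)

/-- The binary tree spanned by `T₀ ∪ T₁` branches at its root, at level `D`, into `T₀` and `T₁`. -/
structure IsSplit (D : ℕ) (T₀ T₁ : Finset ℕ) : Prop where
  lt : ∀ x ∈ T₀, ∀ y ∈ T₁, x < y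
  eq : ∀ x ∈ T₀, ∀ y ∈ T₁, topDiff x y = D
  left : ∀ x ∈ T₀, ∀ y ∈ T₀, x < y → topDiff x y < D
  right : ∀ x ∈ T₁, ∀ y ∈ T₁, x < y → topDiff x y < D

lemma IsSplit.mono {D : ℕ} {T₀ T₁ S₀ S₁ : Finset ℕ} (h : IsSplit D T₀ T₁) (h₀ : S₀ ⊆ T₀)
    (h₁ : S₁ ⊆ T₁) : IsSplit D S₀ S₁ where
  lt x hx y hy := h.lt x (h₀ hx) y (h₁ hy)
  eq x hx y hy := h.eq x (h₀ hx) y (h₁ hy)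
  left x hx y hy := h.left x (h₀ hx) y (h₀ hy)
  right x hx y hy := h.right x (h₁ hx) y (h₁ hy)

lemma IsSplit.disjoint {D : ℕ} {T₀ T₁ : Finset ℕ} (h : IsSplit D T₀ T₁) : Disjoint T₀ T₁ :=
  Finset.disjoint_left.2 fun x h₀ h₁ => (h.lt x h₀ x h₁).false

/-- The root level is that of the minimum `a` and the maximum `b`, and `T₀` collects `a` and the
elements that differ from `a` only below it. Elements of `T₁` differ from `a` exactly at it, so by
`topDiff_ne` not from each other. -/
lemma exists_isSplit {T : Finset ℕ} (hT : 2 ≤ T.card) :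
    ∃ D T₀ T₁, IsSplit D T₀ T₁ ∧ T = T₀ ∪ T₁ ∧ T₀.Nonempty ∧ T₁.Nonempty := by
  have hne : T.Nonempty := Finset.card_pos.1 (by omega)
  have ha := T.min'_mem hne
  have hb := T.max'_mem hne
  have hab : T.min' hne < T.max' hne := Finset.min'_lt_max'_of_card T (by omega)
  have hle : ∀ x ∈ T, T.min' hne ≤ x := fun x hx => T.min'_le x hx
  have hge : ∀ x ∈ T, x ≤ T.max' hne := fun x hx => T.le_max' x hx
  set a := T.min' hne
  set b := T.max' hne
  have mono : ∀ x y z, x < y → y ≤ z → topDiff x y ≤ topDiff x z := by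
    intro x y z hxy hyz
    rcases hyz.eq_or_lt with rfl | h
    · exact le_rfl
    · rw [topDiff_max hxy h]; exact le_max_left _ _
  have mono' : ∀ x y z, x ≤ y → y < z → topDiff y z ≤ topDiff x z := by
    intro x y z hxy hyz
    rcases hxy.eq_or_lt with rfl | h
    · exact le_rfl
    · rw [topDiff_max h hyz]; exact le_max_right _ _
  refine ⟨topDiff a b, T.filter fun x => x = a ∨ topDiff a x < topDiff a b,
    T.filter fun x => ¬ (x = a ∨ topDiff a x < topDiff a b), ?_,
    (Finset.filter_union_filter_not_eq _ _).symm, ⟨a, by simp [ha]⟩, ⟨b, by simp [hb, hab.ne']⟩⟩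
  have key : ∀ x ∈ T, ¬ (x = a ∨ topDiff a x < topDiff a b) →
      a < x ∧ topDiff a x = topDiff a b := by
    intro x hx h
    push Not at h
    have hax := lt_of_le_of_ne (hle x hx) (Ne.symm h.1)
    exact ⟨hax, le_antisymm (mono _ _ _ hax (hge x hx)) h.2⟩
  have hlt : ∀ x ∈ T, (x = a ∨ topDiff a x < topDiff a b) → ∀ y ∈ T,
      ¬ (y = a ∨ topDiff a y < topDiff a b) → x < y := by
    intro x hx h y hy h'
    obtain ⟨h1, h2⟩ := key y hy h'
    rcases h with rfl | h
    · exact h1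
    · by_contra! hyx
      have := mono a y x h1 hyx
      omega
  constructor
  · intro x hx y hy
    rw [Finset.mem_filter] at hx hy
    exact hlt x hx.1 hx.2 y hy.1 hy.2
  · intro x hx y hy
    rw [Finset.mem_filter] at hx hy
    have hxy := hlt x hx.1 hx.2 y hy.1 hy.2
    obtain ⟨h1, h2⟩ := key y hy.1 hy.2
    rcases (hle x hx.1).eq_or_lt with hax | hax
    · rw [← hax, h2]
    · have := topDiff_max hax hxy
      rcases hx.2 with h | h
      · omega
      · rcases max_choice (topDiff a x) (topDiff x y) with h' | h' <;> omega
  · intro x hx y hy hxy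
    rw [Finset.mem_filter] at hx hy
    have h1 := mono' a x y (hle x hx.1) hxy
    have h2 := hle x hx.1
    rcases hy.2 with h | h <;> omega
  · intro x hx y hy hxy
    rw [Finset.mem_filter] at hx hy
    obtain ⟨hx1, hx2⟩ := key x hx.1 hx.2
    obtain ⟨hy1, hy2⟩ := key y hy.1 hy.2
    have h1 := mono' a x y hx1.le hxy
    have h2 := topDiff_ne hx1 hxy
    omega

lemma IsSplit.isLeftComb_insert {D : ℕ} {T₀ T₁ S : Finset ℕ} (h : IsSplit D T₀ T₁) (hS : S ⊆ T₀)
    (hc : IsLeftComb S) {y : ℕ} (hy : y ∈ T₁) : IsLeftComb (insert y S) := by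
  intro a ha b hb c hc' hab hbc
  rw [Finset.mem_insert] at ha hb hc'
  rcases hb with rfl | hb
  · rcases hc' with rfl | hc'
    · omega
    · have := h.lt c (hS hc') b hy
      omega
  rcases ha with rfl | ha
  · have := h.lt b (hS hb) a hy
    omega
  rcases hc' with rfl | hc'
  · rw [h.eq b (hS hb) c hy]
    exact h.left a (hS ha) b (hS hb) hab
  · exact hc a ha b hb c hc' hab hbc

lemma IsSplit.isRightComb_insert {D : ℕ} {T₀ T₁ S : Finset ℕ} (h : IsSplit D T₀ T₁) (hS : S ⊆ T₁)
    (hc : IsRightComb S) {y : ℕ} (hy : y ∈ T₀) : IsRightComb (insert y S) := by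
  intro a ha b hb c hc' hab hbc
  rw [Finset.mem_insert] at ha hb hc'
  rcases hb with rfl | hb
  · rcases ha with rfl | ha
    · omega
    · have := h.lt b hy a (hS ha)
      omega
  rcases hc' with rfl | hc'
  · have := h.lt c hy b (hS hb)
    omega
  rcases ha with rfl | ha
  · rw [h.eq a hy b (hS hb)]
    exact h.right b (hS hb) c (hS hc') hbc
  · exact hc a ha b hb c hc' hab hbc

/-- The binary tree spanned by `T` is, topologically, the complete binary tree of depth `d`. -/
def IsCompleteTree : ℕ → Finset ℕ → Prop
  | 0, T => T.card = 1
  | d + 1, T => ∃ D T₀ T₁, IsSplit D T₀ T₁ ∧ T = T₀ ∪ T₁ ∧ IsCompleteTree d T₀ ∧ IsCompleteTree d T₁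

lemma IsCompleteTree.card_eq {d : ℕ} {T : Finset ℕ} (h : IsCompleteTree d T) : T.card = 2 ^ d := by
  induction d generalizing T with
  | zero => exact h
  | succ d ih =>
    obtain ⟨D, T₀, T₁, hs, rfl, h₀, h₁⟩ := h
    rw [Finset.card_union_of_disjoint hs.disjoint, ih h₀, ih h₁]
    ring

lemma IsCompleteTree.nonempty {d : ℕ} {T : Finset ℕ} (h : IsCompleteTree d T) : T.Nonempty :=
  Finset.card_pos.1 (by rw [h.card_eq]; positivity)

lemma IsCompleteTree.exists_of_le {d w : ℕ} {T : Finset ℕ} (h : IsCompleteTree d T) (hw : w ≤ d) :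
    ∃ T' ⊆ T, IsCompleteTree w T' := by
  induction d generalizing T with
  | zero => obtain rfl : w = 0 := by omega
            exact ⟨T, subset_rfl, h⟩
  | succ d ih =>
    rcases hw.eq_or_lt with rfl | hw
    · exact ⟨T, subset_rfl, h⟩
    · obtain ⟨D, T₀, T₁, hs, rfl, h₀, h₁⟩ := h
      obtain ⟨T', hT', h'⟩ := ih h₀ (by omega)
      exact ⟨T', hT'.trans Finset.subset_union_left, h'⟩

lemma IsCompleteTree.exists_isLeftComb {d : ℕ} {T : Finset ℕ} (h : IsCompleteTree d T) :
    ∃ S ⊆ T, S.card = d + 1 ∧ IsLeftComb S := by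
  induction d generalizing T with
  | zero =>
    refine ⟨T, subset_rfl, h, ?_⟩
    obtain ⟨a, rfl⟩ := Finset.card_eq_one.1 h
    intro x hx y hy z hz hxy
    simp only [Finset.mem_singleton] at hx hy
    omega
  | succ d ih =>
    obtain ⟨D, T₀, T₁, hs, rfl, h₀, h₁⟩ := h
    obtain ⟨S, hS, hc, hL⟩ := ih h₀
    obtain ⟨y, hy⟩ := h₁.nonempty
    have hyS : y ∉ S := fun h' => (hs.lt y (hS h') y hy).false
    refine ⟨insert y S, ?_, by rw [Finset.card_insert_of_notMem hyS, hc],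
      hs.isLeftComb_insert hS hL hy⟩
    exact Finset.insert_subset (Finset.mem_union_right _ hy) (hS.trans Finset.subset_union_left)

lemma IsCompleteTree.exists_isRightComb {d : ℕ} {T : Finset ℕ} (h : IsCompleteTree d T) :
    ∃ S ⊆ T, S.card = d + 1 ∧ IsRightComb S := by
  induction d generalizing T with
  | zero =>
    refine ⟨T, subset_rfl, h, ?_⟩
    obtain ⟨a, rfl⟩ := Finset.card_eq_one.1 h
    intro x hx y hy z hz hxy
    simp only [Finset.mem_singleton] at hx hy
    omega
  | succ d ih =>
    obtain ⟨D, T₀, T₁, hs, rfl, h₀, h₁⟩ := h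
    obtain ⟨S, hS, hc, hL⟩ := ih h₁
    obtain ⟨y, hy⟩ := h₀.nonempty
    have hyS : y ∉ S := fun h' => (hs.lt y hy y (hS h')).false
    refine ⟨insert y S, ?_, by rw [Finset.card_insert_of_notMem hyS, hc],
      hs.isRightComb_insert hS hL hy⟩
    exact Finset.insert_subset (Finset.mem_union_left _ hy) (hS.trans Finset.subset_union_right)

/-- A left comb that meets `T₀` has at most one element in `T₁`: two would have to branch above the
root level. So each level of the tree contributes at most one element. -/
lemma IsCompleteTree.card_le_of_isLeftComb {d : ℕ} {T S : Finset ℕ} (h : IsCompleteTree d T)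
    (hS : S ⊆ T) (hL : IsLeftComb S) : S.card ≤ d + 1 := by
  induction d generalizing T S with
  | zero => exact (Finset.card_le_card hS).trans (le_of_eq h)
  | succ d ih =>
    obtain ⟨D, T₀, T₁, hs, rfl, h₀, h₁⟩ := h
    have hu : S = S ∩ T₀ ∪ S ∩ T₁ := by
      rw [← Finset.inter_union_distrib_left, Finset.inter_eq_left.2 hS]
    have i₀ := ih h₀ Finset.inter_subset_right (hL.mono (Finset.inter_subset_left (s₂ := T₀)))
    have i₁ := ih h₁ Finset.inter_subset_right (hL.mono (Finset.inter_subset_left (s₂ := T₁)))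
    have hcard : S.card ≤ (S ∩ T₀).card + (S ∩ T₁).card := by
      conv_lhs => rw [hu]
      exact Finset.card_union_le _ _
    rcases (S ∩ T₀).eq_empty_or_nonempty with he | ⟨x, hx⟩
    · rw [he] at hcard; simp at hcard; omega
    · have : (S ∩ T₁).card ≤ 1 := by
        by_contra! h2
        obtain ⟨y, hy, z, hz, hyz⟩ := Finset.one_lt_card.1 h2
        rw [Finset.mem_inter] at hx hy hz
        rcases hyz.lt_or_gt with hlt | hlt
        · have q1 := hL x hx.1 y hy.1 z hz.1 (hs.lt x hx.2 y hy.2) hlt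
          have q2 := hs.right y hy.2 z hz.2 hlt
          rw [hs.eq x hx.2 y hy.2] at q1
          omega
        · have q1 := hL x hx.1 z hz.1 y hy.1 (hs.lt x hx.2 z hz.2) hlt
          have q2 := hs.right z hz.2 y hy.2 hlt
          rw [hs.eq x hx.2 z hz.2] at q1
          omega
      omega

lemma IsCompleteTree.card_le_of_isRightComb {d : ℕ} {T S : Finset ℕ} (h : IsCompleteTree d T)
    (hS : S ⊆ T) (hR : IsRightComb S) : S.card ≤ d + 1 := by
  induction d generalizing T S with
  | zero => exact (Finset.card_le_card hS).trans (le_of_eq h)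
  | succ d ih =>
    obtain ⟨D, T₀, T₁, hs, rfl, h₀, h₁⟩ := h
    have hu : S = S ∩ T₀ ∪ S ∩ T₁ := by
      rw [← Finset.inter_union_distrib_left, Finset.inter_eq_left.2 hS]
    have i₀ := ih h₀ Finset.inter_subset_right (hR.mono (Finset.inter_subset_left (s₂ := T₀)))
    have i₁ := ih h₁ Finset.inter_subset_right (hR.mono (Finset.inter_subset_left (s₂ := T₁)))
    have hcard : S.card ≤ (S ∩ T₀).card + (S ∩ T₁).card := by
      conv_lhs => rw [hu]
      exact Finset.card_union_le _ _
    rcases (S ∩ T₁).eq_empty_or_nonempty with he | ⟨x, hx⟩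
    · rw [he] at hcard; simp at hcard; omega
    · have : (S ∩ T₀).card ≤ 1 := by
        by_contra! h2
        obtain ⟨y, hy, z, hz, hyz⟩ := Finset.one_lt_card.1 h2
        rw [Finset.mem_inter] at hx hy hz
        rcases hyz.lt_or_gt with hlt | hlt
        · have q1 := hR y hy.1 z hz.1 x hx.1 hlt (hs.lt z hz.2 x hx.2)
          have q2 := hs.left y hy.2 z hz.2 hlt
          rw [hs.eq z hz.2 x hx.2] at q1
          omega
        · have q1 := hR z hz.1 y hy.1 x hx.1 hlt (hs.lt y hy.2 x hx.2)
          have q2 := hs.left z hz.2 y hy.2 hlt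
          rw [hs.eq y hy.2 x hx.2] at q1
          omega
      omega

/-- A set of more than `(l + r) ^ d` numbers contains a long comb or a complete binary tree. -/
lemma card_le_of_no_comb_of_no_tree (d : ℕ) (T : Finset ℕ) (l r : ℕ)
    (hL : ∀ S ⊆ T, S.card = l → ¬ IsLeftComb S) (hR : ∀ S ⊆ T, S.card = r → ¬ IsRightComb S)
    (hd : ∀ S ⊆ T, ¬ IsCompleteTree d S) : T.card ≤ (l + r) ^ d := by
  induction hn : T.card using Nat.strong_induction_on generalizing T l r d with
  | _ n ih =>
    subst hn
    have hl : l ≠ 0 := by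
      rintro rfl
      exact hL ∅ (Finset.empty_subset _) rfl fun x hx => by simp at hx
    have hr : r ≠ 0 := by
      rintro rfl
      exact hR ∅ (Finset.empty_subset _) rfl fun x hx => by simp at hx
    cases d with
    | zero =>
      rcases T.eq_empty_or_nonempty with rfl | ⟨x, hx⟩
      · simp
      · exact absurd (Finset.card_singleton x) (hd {x} (by simpa using hx))
    | succ d =>
      by_cases h2 : 2 ≤ T.card
      swap
      · have : 0 < (l + r) ^ (d + 1) := by positivity
        omega
      obtain ⟨l, rfl⟩ := Nat.exists_eq_succ_of_ne_zero hl
      obtain ⟨r, rfl⟩ := Nat.exists_eq_succ_of_ne_zero hr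
      obtain ⟨D, T₀, T₁, hs, rfl, hne₀, hne₁⟩ := exists_isSplit h2
      rw [Finset.card_union_of_disjoint hs.disjoint] at ih ⊢
      have c₀ := Finset.card_pos.2 hne₀
      have c₁ := Finset.card_pos.2 hne₁
      have L₀ : ∀ S ⊆ T₀, S.card = l → ¬ IsLeftComb S := by
        intro S hS hc hl
        obtain ⟨y, hy⟩ := hne₁
        have hyS : y ∉ S := fun h' => (hs.lt y (hS h') y hy).false
        exact hL (insert y S)
          (Finset.insert_subset (Finset.mem_union_right _ hy) (hS.trans Finset.subset_union_left))
          (by rw [Finset.card_insert_of_notMem hyS, hc]) (hs.isLeftComb_insert hS hl hy)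
      have R₁ : ∀ S ⊆ T₁, S.card = r → ¬ IsRightComb S := by
        intro S hS hc hl
        obtain ⟨y, hy⟩ := hne₀
        have hyS : y ∉ S := fun h' => (hs.lt y hy y (hS h')).false
        exact hR (insert y S)
          (Finset.insert_subset (Finset.mem_union_left _ hy) (hS.trans Finset.subset_union_right))
          (by rw [Finset.card_insert_of_notMem hyS, hc]) (hs.isRightComb_insert hS hl hy)
      have R₀ : ∀ S ⊆ T₀, S.card = r + 1 → ¬ IsRightComb S :=
        fun S hS => hR S (hS.trans Finset.subset_union_left)
      have L₁ : ∀ S ⊆ T₁, S.card = l + 1 → ¬ IsLeftComb S :=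
        fun S hS => hL S (hS.trans Finset.subset_union_right)
      -- In each half the sum of the two comb bounds drops by one: an element of the other half
      -- would extend a comb.
      have B₀ : ∀ d', (∀ S ⊆ T₀, ¬ IsCompleteTree d' S) → T₀.card ≤ (l + r + 1) ^ d' :=
        fun d' h => by simpa [add_assoc] using ih _ (by omega) d' T₀ l (r + 1) L₀ R₀ h rfl
      have B₁ : ∀ d', (∀ S ⊆ T₁, ¬ IsCompleteTree d' S) → T₁.card ≤ (l + r + 1) ^ d' :=
        fun d' h => by
          simpa [add_assoc, add_comm, add_left_comm] using
            ih _ (by omega) d' T₁ (l + 1) r L₁ R₁ h rfl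
      -- Complete trees of depth `d` in both halves would join to one of depth `d + 1`, so one half
      -- satisfies the bound with exponent `d`.
      have hsum : T₀.card + T₁.card ≤ (l + r + 1) ^ (d + 1) + (l + r + 1) ^ d := by
        by_cases h0 : ∀ S ⊆ T₀, ¬ IsCompleteTree d S
        · have b₀ := B₀ d h0
          have b₁ := B₁ (d + 1) fun S hS => hd S (hS.trans Finset.subset_union_right)
          omega
        · have b₀ := B₀ (d + 1) fun S hS => hd S (hS.trans Finset.subset_union_left)
          have b₁ := B₁ d fun S hS h => by
            push Not at h0
            obtain ⟨S₀, hS₀, h₀⟩ := h0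
            exact hd (S₀ ∪ S) (Finset.union_subset_union hS₀ hS)
              ⟨D, S₀, S, hs.mono hS₀ hS, rfl, h₀, h⟩
          omega
      calc T₀.card + T₁.card ≤ (l + r + 1) ^ (d + 1) + (l + r + 1) ^ d := hsum
        _ = (l + r + 1) ^ d * (l + r + 1 + 1) := by ring
        _ ≤ (l + r + 1 + 1) ^ d * (l + r + 1 + 1) :=
          Nat.mul_le_mul_right _ (Nat.pow_le_pow_left (Nat.le_succ _) d)
        _ = (l.succ + r.succ) ^ (d + 1) := by rw [← pow_succ]; congr 1; omega

/-! ### Avoiding colourings and stepping up -/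

/-- Sets of numbers below `N` can be coloured with `q` colours so that for every `T` of size at least
`t` and every colour, some `u`-subset of `T` has no superset of size at most `m` of that colour. -/
def HasAvoidingColouring (N u m t q : ℕ) : Prop :=
  ∃ col : Finset ℕ → Fin q, ∀ T ⊆ Finset.range N, t ≤ T.card → ∀ c : Fin q,
    ∃ X ⊆ T, X.card = u ∧ ∀ e ⊆ Finset.range N, X ⊆ e → e.card ≤ m → col e ≠ c

lemma hasAvoidingColouring_of_lt {N u m t q : ℕ} (h : N < t) (hq : 0 < q) :
    HasAvoidingColouring N u m t q := by
  refine ⟨fun _ => ⟨0, hq⟩, fun T hT ht => ?_⟩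
  have := Finset.card_le_card hT
  rw [Finset.card_range] at this
  omega

lemma HasAvoidingColouring.mono {N u m t t' q : ℕ} (h : HasAvoidingColouring N u m t q)
    (ht : t ≤ t') : HasAvoidingColouring N u m t' q := by
  obtain ⟨col, h⟩ := h
  exact ⟨col, fun T hT hc => h T hT (ht.trans hc)⟩

/-- Every left or right comb contained in `C` has at most `w` elements. -/
def IsCombFree (w : ℕ) (C : Finset ℕ) : Prop :=
  ∀ S ⊆ C, IsLeftComb S ∨ IsRightComb S → S.card ≤ w

/-- On three common elements the two consecutive levels would have to both increase and decrease. -/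
lemma card_inter_le_two {A B : Finset ℕ} (hA : IsLeftComb A) (hB : IsRightComb B) :
    (A ∩ B).card ≤ 2 := by
  by_contra! h
  obtain ⟨S, hS, hc⟩ := Finset.exists_subset_card_eq (Nat.succ_le_of_lt h)
  have hmem := fun i => hS (S.orderEmbOfFin_mem hc i)
  have h01 : S.orderEmbOfFin hc 0 < S.orderEmbOfFin hc 1 := by simp
  have h12 : S.orderEmbOfFin hc 1 < S.orderEmbOfFin hc 2 := by simp
  have e1 := hA _ (Finset.mem_inter.1 (hmem 0)).1 _ (Finset.mem_inter.1 (hmem 1)).1 _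
    (Finset.mem_inter.1 (hmem 2)).1 h01 h12
  have e2 := hB _ (Finset.mem_inter.1 (hmem 0)).2 _ (Finset.mem_inter.1 (hmem 1)).2 _
    (Finset.mem_inter.1 (hmem 2)).2 h01 h12
  omega

/-- A small set cannot contain large left combs, right combs and comb-free sets at once. -/
lemma three_mul_le_card {A B C e : Finset ℕ} {u w : ℕ} (hA : IsLeftComb A) (hB : IsRightComb B)
    (hC : IsCombFree w C) (hAe : A ⊆ e) (hBe : B ⊆ e) (hCe : C ⊆ e) (cA : A.card = u)
    (cB : B.card = u) (cC : C.card = u) : 3 * u ≤ e.card + 2 + 2 * w := by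
  have h1 := card_inter_le_two hA hB
  have h2 := hC (C ∩ A) Finset.inter_subset_left (Or.inl (hA.mono Finset.inter_subset_right))
  have h3 := hC (C ∩ B) Finset.inter_subset_left (Or.inr (hB.mono Finset.inter_subset_right))
  have h4 := Finset.card_union_add_card_inter A B
  have h5 := Finset.card_union_add_card_inter C (A ∪ B)
  have h6 : (C ∩ (A ∪ B)).card ≤ (C ∩ A).card + (C ∩ B).card := by
    rw [Finset.inter_union_distrib_left]; exact Finset.card_union_le _ _
  have h7 := Finset.card_le_card (Finset.union_subset hCe (Finset.union_subset hAe hBe))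
  omega

/-- A long comb has a set of levels whose every subset is exhibited by a set of one vertex more. -/
lemma IsLeftComb.exists_levels {S : Finset ℕ} (h : IsLeftComb S) (hne : S.Nonempty) :
    ∃ T ⊆ levels S, S.card = T.card + 1 ∧
      ∀ X ⊆ T, ∃ Y ⊆ S, Y.card = X.card + 1 ∧ X ⊆ levels Y := by
  have ha := S.min'_mem hne
  have hlt : ∀ x ∈ S.erase (S.min' hne), S.min' hne < x := fun x hx =>
    S.min'_lt_of_mem_erase_min' hne hx
  set a := S.min' hne
  -- In a left comb the level at which an element branches off from the minimum increases with the
  -- element, so sets of such levels correspond to sets of elements.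
  have hinj : Set.InjOn (topDiff a) (S.erase a : Finset ℕ) := by
    have : StrictMonoOn (topDiff a) (S.erase a : Finset ℕ) := by
      intro x hx y hy hxy
      have q := h a ha x (Finset.mem_of_mem_erase hx) y (Finset.mem_of_mem_erase hy) (hlt x hx) hxy
      exact q.trans_le (by rw [topDiff_max (hlt x hx) hxy]; exact le_max_right _ _)
    exact this.injOn
  refine ⟨(S.erase a).image (topDiff a), ?_, ?_, ?_⟩
  · intro i hi
    obtain ⟨x, hx, rfl⟩ := Finset.mem_image.1 hi
    exact mem_levels.2 ⟨a, ha, x, Finset.mem_of_mem_erase hx, hlt x hx, rfl⟩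
  · rw [Finset.card_image_of_injOn hinj, Finset.card_erase_add_one ha]
  · intro X hX
    obtain ⟨Y, hY, rfl⟩ := Finset.subset_image_iff.1 hX
    have hYS : Y ⊆ S.erase a := by exact_mod_cast hY
    have haY : a ∉ Y := fun h' => Finset.notMem_erase a S (hYS h')
    refine ⟨insert a Y, Finset.insert_subset ha (hYS.trans (Finset.erase_subset _ _)), ?_, ?_⟩
    · rw [Finset.card_insert_of_notMem haY, Finset.card_image_of_injOn (hinj.mono hY)]
    · intro i hi
      obtain ⟨x, hx, rfl⟩ := Finset.mem_image.1 hi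
      exact mem_levels.2 ⟨a, Finset.mem_insert_self _ _, x, Finset.mem_insert_of_mem hx,
        hlt x (hYS hx), rfl⟩

lemma IsRightComb.exists_levels {S : Finset ℕ} (h : IsRightComb S) (hne : S.Nonempty) :
    ∃ T ⊆ levels S, S.card = T.card + 1 ∧
      ∀ X ⊆ T, ∃ Y ⊆ S, Y.card = X.card + 1 ∧ X ⊆ levels Y := by
  have ha := S.max'_mem hne
  have hlt : ∀ x ∈ S.erase (S.max' hne), x < S.max' hne := fun x hx =>
    S.lt_max'_of_mem_erase_max' hne hx
  set a := S.max' hne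
  have hinj : Set.InjOn (fun x => topDiff x a) (S.erase a : Finset ℕ) := by
    have : StrictAntiOn (fun x => topDiff x a) (S.erase a : Finset ℕ) := by
      intro x hx y hy hxy
      have q := h x (Finset.mem_of_mem_erase hx) y (Finset.mem_of_mem_erase hy) a ha hxy (hlt y hy)
      exact q.trans_le (by
        show _ ≤ topDiff x a
        rw [topDiff_max hxy (hlt y hy)]; exact le_max_left _ _)
    exact this.injOn
  refine ⟨(S.erase a).image (fun x => topDiff x a), ?_, ?_, ?_⟩
  · intro i hi
    obtain ⟨x, hx, rfl⟩ := Finset.mem_image.1 hi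
    exact mem_levels.2 ⟨x, Finset.mem_of_mem_erase hx, a, ha, hlt x hx, rfl⟩
  · rw [Finset.card_image_of_injOn hinj, Finset.card_erase_add_one ha]
  · intro X hX
    obtain ⟨Y, hY, rfl⟩ := Finset.subset_image_iff.1 hX
    have hYS : Y ⊆ S.erase a := by exact_mod_cast hY
    have haY : a ∉ Y := fun h' => Finset.notMem_erase a S (hYS h')
    refine ⟨insert a Y, Finset.insert_subset ha (hYS.trans (Finset.erase_subset _ _)), ?_, ?_⟩
    · rw [Finset.card_insert_of_notMem haY, Finset.card_image_of_injOn (hinj.mono hY)]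
    · intro i hi
      obtain ⟨x, hx, rfl⟩ := Finset.mem_image.1 hi
      exact mem_levels.2 ⟨x, Finset.mem_insert_of_mem hx, a, Finset.mem_insert_self _ _,
        hlt x (hYS hx), rfl⟩

lemma levels_mono {e f : Finset ℕ} (h : e ⊆ f) : levels e ⊆ levels f := by
  intro i hi
  obtain ⟨x, hx, y, hy, h', rfl⟩ := mem_levels.1 hi
  exact mem_levels.2 ⟨x, h hx, y, h hy, h', rfl⟩

open Classical in
/-- The first of the three kinds of `u`-sets (left combs, right combs, sets without long combs) that
does not occur in `e`, if `e` is small. -/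
noncomputable def missingKind (u : ℕ) (e : Finset ℕ) : Fin 3 :=
  if ∀ S ⊆ e, S.card = u → ¬ IsLeftComb S then 0
  else if ∀ S ⊆ e, S.card = u → ¬ IsRightComb S then 1 else 2

/-- A complete binary tree contains all three kinds of `u`-sets. -/
lemma IsCompleteTree.exists_missingKind_ne {d u w m : ℕ} {T : Finset ℕ} (h : IsCompleteTree d T)
    (hu : u ≤ d + 1) (hw : w ≤ d) (huw : u ≤ 2 ^ w) (hm : m + 4 + 2 * w < 3 * u) (c : Fin 3) :
    ∃ X ⊆ T, X.card = u ∧ ∀ e, X ⊆ e → e.card ≤ m → missingKind u e ≠ c := by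
  fin_cases c
  · obtain ⟨S, hS, hc, hL⟩ := h.exists_isLeftComb
    obtain ⟨X, hX, hXc⟩ := Finset.exists_subset_card_eq (hu.trans hc.ge)
    refine ⟨X, hX.trans hS, hXc, fun e hXe _ => ?_⟩
    have : ¬ ∀ S ⊆ e, S.card = u → ¬ IsLeftComb S := fun h => h X hXe hXc (hL.mono hX)
    unfold missingKind
    rw [if_neg this]
    split_ifs <;> decide
  · obtain ⟨S, hS, hc, hR⟩ := h.exists_isRightComb
    obtain ⟨X, hX, hXc⟩ := Finset.exists_subset_card_eq (hu.trans hc.ge)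
    refine ⟨X, hX.trans hS, hXc, fun e hXe _ => ?_⟩
    have : ¬ ∀ S ⊆ e, S.card = u → ¬ IsRightComb S := fun h => h X hXe hXc (hR.mono hX)
    unfold missingKind
    rw [if_neg this]
    split_ifs <;> decide
  · obtain ⟨S, hS, hT⟩ := h.exists_of_le hw
    obtain ⟨X, hX, hXc⟩ := Finset.exists_subset_card_eq (huw.trans hT.card_eq.ge)
    refine ⟨X, hX.trans hS, hXc, fun e hXe hem => ?_⟩
    -- A comb in a tree of depth `w` has up to `w + 1` elements, whence `2 + 2 * (w + 1) = 4 + 2 *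
    -- w` in `hm`.
    have hcl : IsCombFree (w + 1) X := by
      rintro Y hY (hL | hR)
      · exact hT.card_le_of_isLeftComb (hY.trans hX) hL
      · exact hT.card_le_of_isRightComb (hY.trans hX) hR
    unfold missingKind
    split_ifs with h1 h2
    · decide
    · decide
    · push Not at h1 h2
      obtain ⟨A, hAe, cA, hA⟩ := h1
      obtain ⟨B, hBe, cB, hB⟩ := h2
      have := three_mul_le_card hA hB hcl hAe hBe hXe cA cB hXc
      omega

/-- Stepping up. -/
lemma HasAvoidingColouring.step {N u m t q d w : ℕ} (h : HasAvoidingColouring N u m t q)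
    (hu : u ≤ d) (hw : w ≤ d) (huw : u + 1 ≤ 2 ^ w) (hm : m + 2 + 2 * w < 3 * u) (ht : 3 ≤ t) :
    HasAvoidingColouring (2 ^ N) (u + 1) (m + 1) (t ^ (2 * d)) (3 * q) := by
  obtain ⟨col, hcol⟩ := h
  refine ⟨fun e => finProdFinEquiv (missingKind (u + 1) e, col (levels e)), ?_⟩
  intro T hT hTc c
  obtain ⟨⟨c₁, c₂⟩, rfl⟩ := finProdFinEquiv.surjective c
  -- The case of combs: `t + 1` vertices give `t` levels, and a superset of at most `m + 1` vertices
  -- has at most `m` levels, so the second coordinate avoids `c₂`.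
  have lift : ∀ S ⊆ T, S.card = t + 1 → (∃ T' ⊆ levels S, S.card = T'.card + 1 ∧
      ∀ X ⊆ T', ∃ Y ⊆ S, Y.card = X.card + 1 ∧ X ⊆ levels Y) →
      ∃ X ⊆ T, X.card = u + 1 ∧ ∀ e ⊆ Finset.range (2 ^ N), X ⊆ e → e.card ≤ m + 1 →
        finProdFinEquiv (missingKind (u + 1) e, col (levels e)) ≠ finProdFinEquiv (c₁, c₂) := by
    rintro S hS hSc ⟨T', hT', hTc', hlev⟩
    obtain ⟨X, hX, hXc, hXcol⟩ := hcol T'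
      (hT'.trans (levels_subset_range (hS.trans hT))) (by omega) c₂
    obtain ⟨Y, hY, hYc, hXY⟩ := hlev X hX
    refine ⟨Y, hY.trans hS, by omega, fun e he hYe hec heq => ?_⟩
    have h1 := finProdFinEquiv.injective heq
    refine hXcol (levels e) (levels_subset_range he) (hXY.trans (levels_mono hYe)) ?_
      (Prod.ext_iff.1 h1).2
    have := card_levels_le e
    omega
  by_cases hd : ∃ S ⊆ T, IsCompleteTree d S
  · obtain ⟨S, hS, hd⟩ := hd
    obtain ⟨X, hX, hXc, hX'⟩ := hd.exists_missingKind_ne (u := u + 1) (w := w) (m := m + 1)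
      (by omega) hw huw (by omega) c₁
    refine ⟨X, hX.trans hS, hXc, fun e _ hXe hec heq => ?_⟩
    exact hX' e hXe hec (Prod.ext_iff.1 (finProdFinEquiv.injective heq)).1
  by_cases hL : ∃ S ⊆ T, S.card = t + 1 ∧ IsLeftComb S
  · obtain ⟨S, hS, hSc, hL⟩ := hL
    exact lift S hS hSc (hL.exists_levels (Finset.card_pos.1 (by omega)))
  by_cases hR : ∃ S ⊆ T, S.card = t + 1 ∧ IsRightComb S
  · obtain ⟨S, hS, hSc, hR⟩ := hR
    exact lift S hS hSc (hR.exists_levels (Finset.card_pos.1 (by omega)))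
  exfalso
  push Not at hd hL hR
  have h1 := card_le_of_no_comb_of_no_tree d T (t + 1) (t + 1) hL hR hd
  have hd0 : d ≠ 0 := by
    rintro rfl
    omega
  -- The inequality `2 * t + 2 < t ^ 2` is the reason for `3 ≤ t`.
  have h2 : (t + 1 + (t + 1)) ^ d < (t ^ 2) ^ d := Nat.pow_lt_pow_left (by nlinarith) hd0
  rw [← pow_mul] at h2
  omega

/-- Iterated stepping up, with a tower-type number of vertices. -/
lemma hasAvoidingColouring_tower {d w x : ℕ} (hx : 3 ≤ x) (hw : w ≤ d) (hd : 0 < d) (H u m : ℕ)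
    (hu : u + H ≤ d + 1) (huw : u + H ≤ 2 ^ w) (hm : m + 2 + 2 * w < 3 * u) :
    HasAvoidingColouring (tower (H + 1) (x - 1)) (u + H) (m + H) (x ^ (2 * d) ^ H)
      (2 * 3 ^ H) := by
  induction H with
  | zero => exact hasAvoidingColouring_of_lt (by simp [tower]; omega) (by norm_num)
  | succ H ih =>
    have h := (ih (by omega) (by omega)).step (d := d) (w := w) (by omega) hw (by omega) (by omega)
      (hx.trans (Nat.le_self_pow (by positivity) x))
    rw [← pow_mul, ← pow_succ, ← mul_assoc, mul_comm 3 2, mul_assoc, ← pow_succ'] at h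
    exact h

/-! ### From avoiding colourings to Ramsey numbers; choice of parameters -/

lemma tower_mono (h : ℕ) {x y : ℕ} (hxy : x ≤ y) : tower h x ≤ tower h y := by
  match h with
  | 0 => exact hxy
  | 1 => exact hxy
  | h + 2 => exact Nat.pow_le_pow_right (by norm_num) (tower_mono (h + 1) hxy)

lemma tower_succ_eq {h : ℕ} (hh : 1 ≤ h) (x : ℕ) : tower (h + 1) x = tower h (2 ^ x) := by
  induction h, hh using Nat.le_induction with
  | base => rfl
  | succ h hh ih =>
    obtain ⟨h, rfl⟩ := Nat.exists_eq_add_of_le' hh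
    show 2 ^ tower (h + 1 + 1) x = 2 ^ tower (h + 1) (2 ^ x)
    rw [ih]

/-- The colouring that gives to each edge its colour in an avoiding colouring has no monochromatic
hedgehog. -/
lemma HasAvoidingColouring.not_isRamsey {N s K t q n : ℕ} (h : HasAvoidingColouring N s K t q)
    (hn : n ≤ N) : ¬ IsRamsey K (generalizedHedgehog t K s) q 2 n := by
  classical
  obtain ⟨col, hcol⟩ := h
  intro hR
  obtain ⟨f, hf, hχ⟩ := hR fun e => col ((Set.toFinite e.1).toFinset.map Fin.valEmbedding)
  set χ : (completeUniform n K).edgeSet → Fin q :=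
    fun e => col ((Set.toFinite e.1).toFinset.map Fin.valEmbedding)
  obtain ⟨c, hc⟩ : ∃ c, ∀ a ∈ χ '' {d | ∃ e ∈ (generalizedHedgehog t K s).edgeSet,
      f '' {v | (v : HedgehogVertex t K s) ∈ e} = d}, a = c := by
    have h1 := (Set.ncard_le_one (Set.toFinite _)).1 (Nat.lt_succ_iff.1 hχ)
    rcases Set.eq_empty_or_nonempty (χ '' {d | ∃ e ∈ (generalizedHedgehog t K s).edgeSet,
      f '' {v | (v : HedgehogVertex t K s) ∈ e} = d}) with he | ⟨c, hc⟩
    · exact ⟨col ∅, fun a ha => by rw [he] at ha; exact ha.elim⟩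
    · exact ⟨c, fun a ha => h1 a ha c hc⟩
  let b : Fin t → ℕ := fun i => (f ⟨Sum.inl i, trivial⟩ : ℕ)
  have hb : Function.Injective b := fun i j hij => by
    have := f.injective (Fin.ext hij)
    exact Sum.inl_injective (congrArg Subtype.val this)
  obtain ⟨X, hX, hXc, hXcol⟩ := hcol (Finset.univ.image b)
    (fun x hx => by
      obtain ⟨i, -, rfl⟩ := Finset.mem_image.1 hx
      exact Finset.mem_range.2 ((Fin.is_lt _).trans_le hn))
    (by rw [Finset.card_image_of_injective _ hb, Finset.card_univ, Fintype.card_fin]) c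
  obtain ⟨S, -, rfl⟩ := Finset.subset_image_iff.1 hX
  rw [Finset.card_image_of_injective _ hb] at hXc
  have hd := hf _ ⟨⟨S, hXc⟩, rfl⟩
  refine hXcol _ ?_ ?_ ?_ (hc _ ⟨⟨_, hd⟩, ⟨_, ⟨⟨S, hXc⟩, rfl⟩, rfl⟩, rfl⟩)
  · intro x hx
    obtain ⟨y, -, rfl⟩ := Finset.mem_map.1 hx
    exact Finset.mem_range.2 (y.2.trans_le hn)
  · intro x hx
    obtain ⟨i, hi, rfl⟩ := Finset.mem_image.1 hx
    refine Finset.mem_map.2 ⟨f ⟨Sum.inl i, trivial⟩, ?_, rfl⟩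
    rw [Set.Finite.mem_toFinset]
    exact ⟨⟨Sum.inl i, trivial⟩, Or.inl ⟨i, hi, rfl⟩, rfl⟩
  · rw [Finset.card_map, ← Set.ncard_eq_toFinset_card]
    exact le_of_eq hd

lemma HasAvoidingColouring.lt_ramseyNumber {N s K t q : ℕ} (h : HasAvoidingColouring N s K t q) :
    ((N + 1 : ℕ) : ℕ∞) ≤ ramseyNumber K (generalizedHedgehog t K s) q 2 := by
  refine le_iInf₂ fun n hn => ?_
  by_contra! hlt
  exact h.not_isRamsey (Nat.lt_succ_iff.1 (by exact_mod_cast hlt)) hn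

-- This absorbs the fixed power to which the iteration raises its initial size, which is about `log
-- t`.
open Filter in
lemma eventually_log_add_two_pow_le (D : ℕ) : ∀ᶠ t : ℕ in atTop, (Nat.log 2 t + 2) ^ D ≤ t := by
  have h : ∀ᶠ n : ℕ in atTop, (n + 2) ^ D ≤ 2 ^ n := by
    have h1 : Tendsto (fun n : ℕ => (n : ℝ) ^ D / 2 ^ n) atTop (nhds 0) :=
      tendsto_pow_const_div_const_pow_of_one_lt D (by norm_num)
    have h2 := (tendsto_add_atTop_nat 2).eventually (h1.eventually_lt_const
      (show (0 : ℝ) < 1 / 4 by norm_num))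
    filter_upwards [h2] with n hn
    rw [div_lt_iff₀ (by positivity), pow_add] at hn
    have : ((n : ℝ) + 2) ^ D < 2 ^ n := by push_cast at hn; linarith
    exact_mod_cast this.le
  have hlog : Tendsto (Nat.log 2) atTop atTop := by
    refine tendsto_atTop.2 fun b => ?_
    filter_upwards [eventually_ge_atTop (2 ^ b)] with t ht
    exact Nat.le_log_of_pow_le (by norm_num) ht
  filter_upwards [hlog.eventually h, eventually_gt_atTop 0] with t ht h0
  exact ht.trans (Nat.pow_log_le_self 2 h0.ne')

/-- The tower height in the lower bound is small compared with `k`. -/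
lemma floor_half_logb_logb (k : ℕ) (h : 2 ≤ ⌊(1 / 2 : ℝ) * Real.logb 2 (Real.logb 2 k)⌋₊) :
    ⌊(1 / 2 : ℝ) * Real.logb 2 (Real.logb 2 k)⌋₊ ≤ Nat.log 2 k ∧ 16 ≤ Nat.log 2 k := by
  set y := Real.logb 2 (k : ℝ) with hy
  have h2 : (4 : ℝ) ≤ Real.logb 2 y := by
    have := (Nat.le_floor_iff' (by norm_num)).1 h
    push_cast at this
    linarith
  have hk : k ≠ 0 := by
    rintro rfl
    simp [hy] at h2
    linarith
  have hy0 : 0 < y := by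
    have h0 : (0 : ℝ) ≤ y := Real.logb_nonneg (by norm_num)
      (by exact_mod_cast Nat.one_le_iff_ne_zero.2 hk)
    refine lt_of_le_of_ne h0 fun h' => ?_
    rw [← h'] at h2
    simp at h2
    linarith
  have hy16 : (16 : ℝ) ≤ y := by
    have := (Real.le_logb_iff_rpow_le (by norm_num) hy0).1 h2
    norm_num at this
    exact this
  have hlog : Nat.log 2 k = ⌊y⌋₊ := by
    rw [hy]
    exact_mod_cast (Real.natFloor_logb_natCast 2 k).symm
  rw [hlog]
  refine ⟨Nat.floor_le_floor ?_, Nat.le_floor (by exact_mod_cast hy16)⟩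
  -- Bernoulli's inequality for `(1 + 1) ^ y`.
  have h3 : Real.logb 2 y ≤ y := by
    rw [Real.logb_le_iff_le_rpow (by norm_num) hy0]
    have hb := one_add_mul_self_le_rpow_one_add (s := 1) (by norm_num) (p := y) (by linarith)
    norm_num at hb
    linarith
  linarith

lemma six_mul_add_six_le_two_pow {l : ℕ} (hl : 16 ≤ l) : 6 * l + 6 ≤ 2 ^ l := by
  induction l, hl using Nat.le_induction with
  | base => norm_num
  | succ l hl ih => rw [pow_succ]; omega

lemma tower_le_ramseyNumber {k H : ℕ} (hH : 2 ≤ H → H ≤ Nat.log 2 k ∧ 16 ≤ Nat.log 2 k) :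
    ∀ᶠ t : ℕ in Filter.atTop, ((tower H t : ℕ) : ℕ∞) ≤
      ramseyNumber (2 * k + 1) (balancedHedgehog (2 * k + 1) t) (2 * 3 ^ H) 2 := by
  have hs : (2 * k + 1 + 1) / 2 = k + 1 := by omega
  unfold balancedHedgehog
  rw [hs]
  by_cases h2 : 2 ≤ H
  · obtain ⟨hHk, hk⟩ := hH h2
    set l := Nat.log 2 k
    have hk0 : k ≠ 0 := by
      rintro rfl
      simp [l] at hk
    have hkl : 2 ^ l ≤ k := Nat.pow_log_le_self 2 hk0
    have hkl' : k < 2 ^ (l + 1) := Nat.lt_pow_succ_log_self (by norm_num) k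
    have hl : 6 * l + 6 ≤ 2 ^ l := six_mul_add_six_le_two_pow hk
    filter_upwards [eventually_log_add_two_pow_le ((2 * (k + 1)) ^ H),
      Filter.eventually_ge_atTop 2] with t ht ht2
    have hx : 3 ≤ Nat.log 2 t + 2 := by
      have := Nat.log_pos (b := 2) (by norm_num) ht2
      omega
    -- The iteration starts with `k + 1 - H` and `2 * k + 1 - H` so as to end with body part `k + 1`
    -- and uniformity `2 * k + 1`. Its size condition becomes `2 * H + 2 * (l + 1) < k`. The start
    -- `x - 1 = log t + 1` costs one exponential, so height `H + 1` in it is at least height `H` in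
    -- `t`.
    have hcol := (hasAvoidingColouring_tower (d := k + 1) (w := l + 1) hx (by omega) (by omega) H
      (k + 1 - H) (2 * k + 1 - H) (by omega) (by omega) (by omega)).mono ht
    rw [show k + 1 - H + H = k + 1 by omega, show 2 * k + 1 - H + H = 2 * k + 1 by omega] at hcol
    refine le_trans ?_ hcol.lt_ramseyNumber
    rw [tower_succ_eq (by omega)]
    have := tower_mono H (Nat.lt_pow_succ_log_self (b := 2) (by norm_num) t).le
    exact_mod_cast this.trans (Nat.le_succ _)
  -- For `H ≤ 1` the tower is `t` itself, and `t - 1` vertices cannot contain the body.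
  · filter_upwards [Filter.eventually_ge_atTop 1] with t ht
    have hcol : HasAvoidingColouring (t - 1) (k + 1) (2 * k + 1) t (2 * 3 ^ H) :=
      hasAvoidingColouring_of_lt (by omega) (by positivity)
    have := hcol.lt_ramseyNumber
    rw [Nat.sub_add_cancel ht] at this
    have hH' : H = 0 ∨ H = 1 := by omega
    rcases hH' with rfl | rfl <;> exact this

end HypergraphRamsey

theorem mainTheorem3 :
    ∃ c : ℝ, 0 < c ∧ ∃ q : ℕ → ℕ, (∀ k : ℕ, 2 ≤ q k) ∧
      ∀ k : ℕ, ∀ᶠ t : ℕ in Filter.atTop,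
        HypergraphRamsey.ramseyNumber (2 * k + 1)
            (HypergraphRamsey.balancedHedgehog (2 * k + 1) t) 2 2 ≤ ((t ^ (k + 3) : ℕ) : ℕ∞) ∧
        ((HypergraphRamsey.tower ⌊c * Real.logb 2 (Real.logb 2 (k : ℝ))⌋₊ t : ℕ) : ℕ∞) ≤
          HypergraphRamsey.ramseyNumber (2 * k + 1)
            (HypergraphRamsey.balancedHedgehog (2 * k + 1) t) (q k) 2 := by
  -- Two colours at the start, tripled in each step. With `c = 1 / 2`, a height of at least 2 forces
  -- `log k ≥ 16`, which leaves room for the steps.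
  refine ⟨1 / 2, by norm_num,
    fun k => 2 * 3 ^ ⌊(1 / 2 : ℝ) * Real.logb 2 (Real.logb 2 (k : ℝ))⌋₊, fun k => ?_, fun k => ?_⟩
  · exact Nat.le_mul_of_pos_right 2 (by positivity)
  · filter_upwards [Filter.eventually_ge_atTop (8 * (k + 1) ^ 2),
      HypergraphRamsey.tower_le_ramseyNumber (HypergraphRamsey.floor_half_logb_logb k)] with t ht h
    exact ⟨iInf₂_le _ (HypergraphRamsey.isRamsey_balancedHedgehog ht), h⟩
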